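/- Let $\Theta\subseteq\mathbb{R}^m$ be nonempty and compact, let $(Z_j)_{j\in\mathbb{N}}$ be independent, identically distributed $\mathbb{R}^d$-valued random vectors on a probability space $(\Omega,\mathcal{F},\mathbb{P})$ with common law $\mathbb{P}^Z$, and let $G:\Theta\times\mathbb{R}^d\to\mathbb{R}$. Assume: (A1) $G(\theta,\cdot)$ is Borel measurable for every $\theta\in\Theta$. (A2) $\xi:\mathbb{R}^d\to\mathbb{R}$ is a strictly positive, Borel measurable, $\mathbb{P}^Z$-integrable function with $\sup_{\theta\in\Theta}|G(\theta,z)|\le\xi(z)$ for all $z\in\mathbb{R}^d$. (A3) $\overline{\Theta}\subseteq\Theta$ is an at most countable subset, and there are $(\mathbb{P}^Z)^n$-null sets $N_n$ $(n\ge 1)$, such that $$\inf_{\vartheta\in\overline{\Theta}}\big|\mathbb{E}[G(\vartheta,Z_1)]-\mathbb{E}[G(\theta,Z_1)]\big|=\inf_{\vartheta\in\overline{\Theta}}\max_{1\le j\le n}\big|G(\theta,z_j)-G(\vartheta,z_j)\big|=0$$ for all $n\ge 1$, $\theta\in\Theta$ and $(z_1,\dots,z_n)\in(\mathbb{R}^d)^n\setminus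 N_n$ (with $\inf\emptyset=\infty$). Assume moreover that $\xi$ is square $\mathbb{P}^Z$-integrable, and put $\|\xi\|_{\mathbb{P}^Z,2}=\big(\int\xi^2\,d\mathbb{P}^Z\big)^{1/2}$. Let $\mathbb{F}^\Theta=\{G(\theta,\cdot)\mid\theta\in\Theta\}$. For a probability measure $\mathbb{Q}$ on $\mathbb{R}^d$ and $\eta>0$ let $N(\eta,\mathbb{F}^\Theta,L^2(\mathbb{Q}))\in\mathbb{N}\cup\{\infty\}$ be the minimal number of closed $L^2(\mathbb{Q})$-balls of radius $\eta$ with centers in $\mathbb{F}^\Theta$ that cover $\mathbb{F}^\Theta$ ($\infty$ if there is no finite cover), and define $$J(\mathbb{F}^\Theta,\xi,\delta)=\int_0^\delta\sup_{\mathbb{Q}}\sqrt{\ln\big(2N(\varepsilon\|\xi\|_{\mathbb{Q},2},\mathbb{F}^\Theta,L^2(\mathbb{Q}))\big)}\,d\varepsilon\in[0,\infty],$$ where the supremum is over all Borel probability measures $\mathbb{Q}$ on $\mathbb{R}^d$ with finite support. Then for every $n\ge 1$ the random variables below are integrable, and $$\mathbb{E}\Big[\Big|\inf_{\theta\in\Theta}\frac1n\sum_{j=1}^nG(\theta,Z_j)-\inf_{\theta\in\Theta}\mathbb{E}[G(\theta,Z_1)]\Big|\Big]\le\mathbb{E}\Big[\sup_{\theta\in\overline{\Theta}}\Big|\frac1n\sum_{j=1}^nG(\theta,Z_j)-\mathbb{E}[G(\theta,Z_1)]\Big|\Big]\le\frac{16\sqrt2\,\|\xi\|_{\mathbb{P}^Z,2}}{\sqrt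 n}\,J(\mathbb{F}^\Theta,\xi,1/2).$$ (If the probability space is not complete, the first random variable is understood to be $\mathbb{P}$-a.s. equal to a measurable one.) -/

import Mathlib

open MeasureTheory ProbabilityTheory
open scoped ENNReal

namespace SAA

noncomputable section

/-- The condition that `G θ` is Borel measurable for every parameter `θ ∈ Θ`. -/
def MeasurableGoals {m d : ℕ} (Θ : Set (EuclideanSpace ℝ (Fin m)))
    (G : EuclideanSpace ℝ (Fin m) → EuclideanSpace ℝ (Fin d) → ℝ) : Prop :=
  ∀ θ ∈ Θ, Measurable (G θ)

/-- `ξ` is a strictly positive, Borel measurable, `P`-integrable function with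
`sup_{θ ∈ Θ} |G θ z| ≤ ξ z` for all `z`. -/
structure IsPositiveIntegrableEnvelope {m d : ℕ} (Θ : Set (EuclideanSpace ℝ (Fin m)))
    (G : EuclideanSpace ℝ (Fin m) → EuclideanSpace ℝ (Fin d) → ℝ)
    (P : Measure (EuclideanSpace ℝ (Fin d)))
    (ξ : EuclideanSpace ℝ (Fin d) → ℝ) : Prop where
  measurable : Measurable ξ
  pos : ∀ z, 0 < ξ z
  integrable : Integrable ξ P
  bound : ∀ z, ∀ θ ∈ Θ, |G θ z| ≤ ξ z

/-- `Θ'` is an at most countable subset of `Θ` such that, for every `n ≥ 1`, there is a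
`Pⁿ`-null set `N` outside of which, for all `θ ∈ Θ`,
`inf_{ϑ ∈ Θ'} |E G(ϑ, Z) - E G(θ, Z)| = 0` and
`inf_{ϑ ∈ Θ'} max_{j ≤ n} |G(θ, z_j) - G(ϑ, z_j)| = 0`.
The infima are taken in `[0, ∞]`, so that the infimum over the empty set is `∞`. -/
structure IsApproximatingSubset {m d : ℕ} (Θ : Set (EuclideanSpace ℝ (Fin m)))
    (G : EuclideanSpace ℝ (Fin m) → EuclideanSpace ℝ (Fin d) → ℝ)
    (P : Measure (EuclideanSpace ℝ (Fin d)))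
    (Θ' : Set (EuclideanSpace ℝ (Fin m))) : Prop where
  subset : Θ' ⊆ Θ
  countable : Θ'.Countable
  approx_mean : ∀ θ ∈ Θ,
    ⨅ ϑ ∈ Θ', ENNReal.ofReal |∫ z, G ϑ z ∂P - ∫ z, G θ z ∂P| = 0
  approx_sample : ∀ n : ℕ, 0 < n →
    ∃ N : Set (Fin n → EuclideanSpace ℝ (Fin d)),
      Measure.pi (fun _ : Fin n => P) N = 0 ∧
      ∀ θ ∈ Θ, ∀ z : Fin n → EuclideanSpace ℝ (Fin d), z ∉ N →
        ⨅ ϑ ∈ Θ', ⨆ j : Fin n, ENNReal.ofReal |G θ (z j) - G ϑ (z j)| = 0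

/-- The covering number `N(η, F, L²(Q))`: the minimal number of closed `L²(Q)`-balls of radius `η`
with centers in `F` that cover `F`; it is `∞` if there is no finite cover. -/
def coveringNumber {X : Type*} [MeasurableSpace X] (η : ℝ≥0∞) (F : Set (X → ℝ))
    (Q : Measure X) : ℕ∞ :=
  ⨅ (C : Set (X → ℝ)) (_ : C ⊆ F) (_ : ∀ f ∈ F, ∃ g ∈ C, eLpNorm (f - g) 2 Q ≤ η), C.encard

/-- The probability measures with finite support. -/
def finSuppProb (X : Type*) [MeasurableSpace X] : Set (Measure X) :=
  {Q | IsProbabilityMeasure Q ∧ ∃ S : Finset X, Q (S : Set X)ᶜ = 0}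

/-- `√(ln (2 N))` as an element of `[0, ∞]`, for `N` in `{0, 1, 2, …, ∞}`, equal to `∞` at `∞`. -/
def sqrtLogTwoMul (N : ℕ∞) : ℝ≥0∞ :=
  open Classical in
  if N = ⊤ then ⊤ else ENNReal.ofReal (Real.sqrt (Real.log (2 * (N.toNat : ℝ))))

/-- The uniform entropy integral `J(F, C, δ)`, with values in `[0, ∞]`. -/
def entropyIntegral {X : Type*} [MeasurableSpace X] (F : Set (X → ℝ)) (C : X → ℝ) (δ : ℝ) :
    ℝ≥0∞ :=
  ∫⁻ ε in Set.Ioc 0 δ, ⨆ Q ∈ finSuppProb X,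
    sqrtLogTwoMul (coveringNumber (ENNReal.ofReal ε * eLpNorm C 2 Q) F Q)

/-- The sample average `(1/n) ∑_{j = 1}^{n} h(Z_j(ω))`; the samples are indexed from `0`. -/
def sampleAverage {Ω X : Type*} (Z : ℕ → Ω → X) (n : ℕ) (h : X → ℝ) (ω : Ω) : ℝ :=
  (1 / (n : ℝ)) * ∑ j ∈ Finset.range n, h (Z j ω)

/-- The absolute error of the optimal value of the sample average approximation. -/
def optimalValueError {m d : ℕ} {Ω : Type*} (Θ : Set (EuclideanSpace ℝ (Fin m)))
    (G : EuclideanSpace ℝ (Fin m) → EuclideanSpace ℝ (Fin d) → ℝ)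
    (P : Measure (EuclideanSpace ℝ (Fin d))) (Z : ℕ → Ω → EuclideanSpace ℝ (Fin d))
    (n : ℕ) (ω : Ω) : ℝ :=
  |(⨅ θ : Θ, sampleAverage Z n (G θ) ω) - ⨅ θ : Θ, ∫ z, G θ z ∂P|

/-- The supremum over `T` of the absolute deviations of the sample averages from the means. -/
def supDeviation {m d : ℕ} {Ω : Type*} (T : Set (EuclideanSpace ℝ (Fin m)))
    (G : EuclideanSpace ℝ (Fin m) → EuclideanSpace ℝ (Fin d) → ℝ)
    (P : Measure (EuclideanSpace ℝ (Fin d))) (Z : ℕ → Ω → EuclideanSpace ℝ (Fin d))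
    (n : ℕ) (ω : Ω) : ℝ :=
  ⨆ θ : T, |sampleAverage Z n (G θ) ω - ∫ z, G θ z ∂P|

end

end SAA

/-!
The error of the optimal value is almost surely bounded by the supremum of the deviations over the
countable set `Θ'`: outside a null set the approximation hypothesis makes the infima over `Θ` of the
sample averages and of the means equal to the infima over `Θ'`, and the infimum is Lipschitz for the
supremum norm. Countability gives measurability and the envelope gives integrability
(`integrable_supDeviation`, `ae_optimalValueError_le_supDeviation`).

The entropy bound is symmetrization followed by chaining. An independent copy of the sample, and
the invariance of the joint law under exchanging single observations with their copies, replace the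
centered sums by Rademacher sums at the price of a factor `2`
(`lintegral_iSup_enorm_centered_le_signedSum`). Given the sample, the Rademacher sums are
subgaussian for the `L²` metric of the empirical measure, a finitely supported probability measure.
Chaining along nets of radii `2⁻ᵏ ‖ξ‖`, with `{0}` as the net of radius `‖ξ‖`, and comparison
of the resulting dyadic sum with the entropy integral over `(0, 1/2]` give the constant `4 √2`
(`sum_le_chaining`, `sum_iSup_enorm_signedSum_le`). Finally, the mean of the empirical norm of `ξ`
is at most its norm in `L²(P)`. Altogether the bound holds with `8 √2` in place of `16 √2`.

Expectations of suprema are computed as lower Lebesgue integrals of `[0, ∞]`-valued suprema, so that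
the suprema need not be shown to be bounded or integrable there, and Rademacher expectations are
finite sums over all sign vectors.
-/

namespace SAA

/-! ### Rademacher averages over all sign vectors -/

/-- The sign `±1` encoded by a Boolean; a vector `s : ι → Bool` stands for a Rademacher vector,
and expectations over it are written as sums over all `s`, not normalized by `2 ^ |ι|`. -/
noncomputable def boolSign (b : Bool) : ℝ := if b then 1 else -1

/-- The Rademacher sum `∑ j, ± a j` for the sign vector `s`. -/
noncomputable def signedSum {ι : Type*} [Fintype ι] (s : ι → Bool) (a : ι → ℝ) : ℝ :=
  ∑ j, boolSign (s j) * a j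

section Rademacher

variable {ι κ : Type*} [Fintype ι]

lemma boolSign_sq (b : Bool) : boolSign b ^ 2 = 1 := by
  cases b <;> simp [boolSign]

lemma signedSum_sub (s : ι → Bool) (a b : ι → ℝ) :
    signedSum s (a - b) = signedSum s a - signedSum s b := by
  simp [signedSum, mul_sub]

lemma signedSum_smul (s : ι → Bool) (c : ℝ) (a : ι → ℝ) :
    signedSum s (c • a) = c * signedSum s a := by
  simp only [signedSum, Pi.smul_apply, smul_eq_mul, Finset.mul_sum]
  exact Finset.sum_congr rfl fun j _ => by ring

lemma abs_signedSum_le_sqrt (s : ι → Bool) {a : ι → ℝ} {r : ℝ} (hr : 0 ≤ r)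
    (ha : ∑ j, a j ^ 2 ≤ r ^ 2) :
    |signedSum s a| ≤ Real.sqrt (Fintype.card ι) * r := by
  have h := Finset.sum_mul_sq_le_sq_mul_sq Finset.univ (fun j => boolSign (s j)) a
  simp only [boolSign_sq, Finset.sum_const, Finset.card_univ, nsmul_eq_mul, mul_one] at h
  apply abs_le_of_sq_le_sq _ (by positivity)
  rw [mul_pow, Real.sq_sqrt (by positivity)]
  exact h.trans (by gcongr)

variable [DecidableEq ι]

/-- Rademacher sums are subgaussian. -/
lemma sum_exp_signedSum_le (a : ι → ℝ) :
    ∑ s : ι → Bool, Real.exp (signedSum s a) ≤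
      Fintype.card (ι → Bool) * Real.exp ((∑ j, a j ^ 2) / 2) := by
  have h1 : ∑ s : ι → Bool, Real.exp (signedSum s a) = ∏ j, (2 * Real.cosh (a j)) := by
    simp only [signedSum, Real.exp_sum]
    rw [← Fintype.prod_sum (fun j (b : Bool) => Real.exp (boolSign b * a j))]
    refine Finset.prod_congr rfl fun j _ => ?_
    simp [boolSign, Real.cosh_eq]
    ring
  have h2 : (Fintype.card (ι → Bool) : ℝ) = ∏ _j : ι, (2 : ℝ) := by simp
  rw [h1, h2, Finset.sum_div, Real.exp_sum, ← Finset.prod_mul_distrib]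
  refine Finset.prod_le_prod (fun j _ => by positivity) fun j _ => ?_
  gcongr
  exact Real.cosh_le_exp_half_sq _

/-- The maximal inequality for finitely many Rademacher sums. The bound holds for every selection
`M` of values dominated by the maximum, so that no maximum has to be written down. -/
lemma sum_le_of_le_abs_signedSum {T : Finset κ} {a : κ → ι → ℝ} {σ : ℝ} (hσ : 0 < σ)
    (ha : ∀ t ∈ T, ∑ j, a t j ^ 2 ≤ σ ^ 2) {M : (ι → Bool) → ℝ}
    (hM : ∀ s, ∃ t ∈ T, M s ≤ |signedSum s (a t)|) :
    ∑ s, M s ≤ Fintype.card (ι → Bool) * (σ * Real.sqrt (2 * Real.log (2 * T.card))) := by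
  have hT : 0 < T.card := by
    obtain ⟨t, ht, -⟩ := hM fun _ => true
    exact Finset.card_pos.2 ⟨t, ht⟩
  have hT' : (1 : ℝ) ≤ T.card := by exact_mod_cast hT
  set W : ℝ := (Fintype.card (ι → Bool) : ℝ) with hW
  have hWpos : 0 < W := by rw [hW]; exact_mod_cast Fintype.card_pos
  set l := Real.log (2 * T.card) with hl
  have hlpos : 0 < l := Real.log_pos (by linarith)
  -- the choice of `lam` that balances the two terms of the exponential moment bound
  set lam := Real.sqrt (2 * l) / σ with hlam
  have hlampos : 0 < lam := by positivity
  have hlamsq : lam ^ 2 * σ ^ 2 = 2 * l := by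
    rw [hlam, div_pow, Real.sq_sqrt (by positivity)]
    field_simp
  set m := ∑ s, W⁻¹ * M s with hm
  have hjensen : Real.exp (lam * m) ≤ ∑ s, W⁻¹ * Real.exp (lam * M s) := by
    have h := convexOn_exp.map_sum_le (t := Finset.univ) (w := fun _ : ι → Bool => W⁻¹)
      (p := fun s => lam * M s) (fun _ _ => by positivity)
      (by simp [← hW, hWpos.ne', - Fintype.card_pi]) (fun _ _ => Set.mem_univ _)
    simp only [smul_eq_mul] at h
    rw [hm, Finset.mul_sum]
    simpa only [mul_left_comm lam] using h
  have hpoint : ∀ s, Real.exp (lam * M s) ≤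
      ∑ t ∈ T, (Real.exp (signedSum s (lam • a t)) + Real.exp (signedSum s ((-lam) • a t))) := by
    intro s
    obtain ⟨t, ht, hts⟩ := hM s
    calc Real.exp (lam * M s) ≤ Real.exp |signedSum s (lam • a t)| := by
          rw [signedSum_smul, abs_mul, abs_of_pos hlampos]
          gcongr
      _ ≤ Real.exp (signedSum s (lam • a t)) + Real.exp (signedSum s ((-lam) • a t)) := by
          simp only [signedSum_smul, neg_mul]
          rcases abs_choice (lam * signedSum s (a t)) with h | h <;> rw [h] <;>
            linarith [Real.exp_pos (lam * signedSum s (a t)),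
              Real.exp_pos (-(lam * signedSum s (a t)))]
      _ ≤ _ := Finset.single_le_sum
          (f := fun t => Real.exp (signedSum s (lam • a t)) +
            Real.exp (signedSum s ((-lam) • a t))) (fun t _ => by positivity) ht
  have hexp : ∀ c : ℝ, c ^ 2 = lam ^ 2 → ∀ t ∈ T,
      ∑ s, Real.exp (signedSum s (c • a t)) ≤ W * Real.exp l := by
    intro c hc t ht
    refine (sum_exp_signedSum_le _).trans ?_
    gcongr
    simp only [Pi.smul_apply, smul_eq_mul, mul_pow, hc, ← Finset.mul_sum]
    nlinarith [ha t ht, sq_nonneg lam, hlamsq]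
  have hfinal : Real.exp (lam * m) ≤ Real.exp (2 * l) := by
    calc Real.exp (lam * m) ≤ ∑ s, W⁻¹ * Real.exp (lam * M s) := hjensen
      _ ≤ ∑ s, W⁻¹ * ∑ t ∈ T, (Real.exp (signedSum s (lam • a t)) +
            Real.exp (signedSum s ((-lam) • a t))) := by
          gcongr with s
          exact hpoint s
      _ = W⁻¹ * ∑ t ∈ T, (∑ s, Real.exp (signedSum s (lam • a t)) +
            ∑ s, Real.exp (signedSum s ((-lam) • a t))) := by
          rw [← Finset.mul_sum, Finset.sum_comm]
          simp only [Finset.sum_add_distrib]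
      _ ≤ W⁻¹ * ∑ t ∈ T, (W * Real.exp l + W * Real.exp l) := by
          gcongr with t ht
          · exact hexp _ rfl t ht
          · exact hexp _ (by ring) t ht
      _ = (2 * T.card) * Real.exp l := by
          rw [Finset.sum_const, nsmul_eq_mul]
          field_simp
          ring
      _ = Real.exp (2 * l) := by
          rw [two_mul l, Real.exp_add, hl, Real.exp_log (by positivity)]
  have hle : lam * m ≤ 2 * l := Real.exp_le_exp.1 hfinal
  have hmle : m ≤ σ * Real.sqrt (2 * l) := by
    have h2 : lam * (σ * Real.sqrt (2 * l)) = 2 * l := by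
      rw [hlam]
      field_simp
      exact Real.sq_sqrt (by positivity)
    exact le_of_mul_le_mul_left (hle.trans h2.ge) hlampos
  calc ∑ s, M s = W * m := by
        rw [hm, ← Finset.mul_sum, mul_inv_cancel_left₀ hWpos.ne']
    _ ≤ _ := by gcongr

/-! ### Chaining -/

/-- Dudley's chaining bound. If the points of the net `T (k + 1)` lie within `r 2⁻ᵏ` of the net
`T k` and `T 0 = {0}`, then the Rademacher sums over `T K` are reached in `K` steps, and step `k`
needs the maximal inequality only for the `|T (k + 1)|` increments from `T (k + 1)` to `T k`. -/
lemma sum_le_chaining {r : ℝ} (hr : 0 < r) {T : ℕ → Finset (ι → ℝ)} (hT0 : T 0 = {0})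
    (hT : ∀ k, ∀ a ∈ T (k + 1), ∃ b ∈ T k, ∑ j, (a j - b j) ^ 2 ≤ (r * (1 / 2) ^ k) ^ 2) (K : ℕ)
    {M : (ι → Bool) → ℝ} (hM : ∀ s, ∃ a ∈ T K, M s ≤ |signedSum s a|) :
    ∑ s, M s ≤ Fintype.card (ι → Bool) * ∑ k ∈ Finset.range K,
      r * (1 / 2) ^ k * Real.sqrt (2 * Real.log (2 * (T (k + 1)).card)) := by
  induction K generalizing M with
  | zero =>
    simp only [Finset.range_zero, Finset.sum_empty, mul_zero]
    refine Finset.sum_nonpos fun s _ => ?_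
    obtain ⟨a, ha, h⟩ := hM s
    rw [hT0, Finset.mem_singleton] at ha
    simpa [ha, signedSum] using h
  | succ K ih =>
    have hproj : ∀ a, ∃ b, a ∈ T (K + 1) →
        b ∈ T K ∧ ∑ j, (a j - b j) ^ 2 ≤ (r * (1 / 2) ^ K) ^ 2 := by
      intro a
      by_cases ha : a ∈ T (K + 1)
      · obtain ⟨b, hb⟩ := hT K a ha
        exact ⟨b, fun _ => hb⟩
      · exact ⟨0, fun h => absurd h ha⟩
    choose p hp using hproj
    choose a ha hMa using hM
    have hlink := sum_le_of_le_abs_signedSum (T := T (K + 1)) (a := fun a => a - p a)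
      (σ := r * (1 / 2) ^ K) (by positivity) (fun t ht => (hp t ht).2)
      (M := fun s => |signedSum s (a s - p (a s))|) (fun s => ⟨a s, ha s, le_rfl⟩)
    have hprev := ih (M := fun s => |signedSum s (p (a s))|)
      (fun s => ⟨p (a s), (hp _ (ha s)).1, le_rfl⟩)
    calc ∑ s, M s ≤ ∑ s, (|signedSum s (p (a s))| + |signedSum s (a s - p (a s))|) := by
          gcongr with s
          refine (hMa s).trans ?_
          rw [signedSum_sub]
          linarith [abs_sub_abs_le_abs_sub (signedSum s (a s)) (signedSum s (p (a s)))]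
      _ ≤ _ := by
          rw [Finset.sum_add_distrib, Finset.sum_range_succ, mul_add]
          exact add_le_add hprev hlink

end Rademacher

/-! ### Covering numbers and the entropy integral -/

section Covering

variable {X : Type*}

/-- The norm of `L²` of the empirical measure, as a real number. -/
noncomputable def empiricalNorm {n : ℕ} (f : X → ℝ) (z : Fin n → X) : ℝ :=
  Real.sqrt ((∑ j, f (z j) ^ 2) / n)

lemma empiricalNorm_nonneg {n : ℕ} (f : X → ℝ) (z : Fin n → X) : 0 ≤ empiricalNorm f z :=
  Real.sqrt_nonneg _

lemma sum_sq_eq_empiricalNorm {n : ℕ} (hn : 0 < n) (f : X → ℝ) (z : Fin n → X) :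
    ∑ j, f (z j) ^ 2 = n * empiricalNorm f z ^ 2 := by
  have : (0 : ℝ) < n := by exact_mod_cast hn
  rw [empiricalNorm, Real.sq_sqrt (by positivity)]
  field_simp

variable [MeasurableSpace X]

lemma coveringNumber_anti (F : Set (X → ℝ)) (Q : Measure X) :
    Antitone fun η : ℝ≥0∞ => coveringNumber η F Q := by
  intro η η' h
  refine le_iInf fun C => le_iInf fun hC => le_iInf fun hcov => ?_
  refine iInf_le_of_le C (iInf_le_of_le hC (iInf_le_of_le (fun f hf => ?_) le_rfl))
  obtain ⟨g, hg, hfg⟩ := hcov f hf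
  exact ⟨g, hg, hfg.trans h⟩

lemma exists_finset_cover {η : ℝ≥0∞} {F : Set (X → ℝ)} {Q : Measure X}
    (h : coveringNumber η F Q ≠ ⊤) :
    ∃ C : Finset (X → ℝ), (C : Set (X → ℝ)) ⊆ F ∧
      (∀ f ∈ F, ∃ g ∈ C, eLpNorm (f - g) 2 Q ≤ η) ∧ C.card ≤ (coveringNumber η F Q).toNat := by
  have hlt : coveringNumber η F Q < (coveringNumber η F Q) + 1 := (ENat.lt_add_one_iff h).2 le_rfl
  conv_lhs at hlt => rw [coveringNumber]
  simp only [iInf_lt_iff] at hlt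
  obtain ⟨C, hCF, hcov, hcard⟩ := hlt
  have hcard' : C.encard ≤ coveringNumber η F Q := (ENat.lt_add_one_iff h).1 hcard
  have hfin : C.Finite := Set.encard_ne_top_iff.1 (ne_top_of_le_ne_top h hcard')
  refine ⟨hfin.toFinset, by simpa using hCF, by simpa using hcov, ?_⟩
  rw [hfin.encard_eq_coe_toFinset_card] at hcard'
  simpa using ENat.toNat_le_toNat hcard' h

lemma sqrtLogTwoMul_mono : Monotone sqrtLogTwoMul := by
  intro a b hab
  by_cases hb : b = ⊤
  · simp [sqrtLogTwoMul, hb]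
  have ha : a ≠ ⊤ := ne_top_of_le_ne_top hb hab
  simp only [sqrtLogTwoMul, ha, hb, if_false]
  have h : a.toNat ≤ b.toNat := ENat.toNat_le_toNat hab hb
  rcases Nat.eq_zero_or_pos a.toNat with h0 | h0
  · simp [h0]
  · gcongr

lemma ofReal_sqrt_log_le {N : ℕ∞} (hN : N ≠ ⊤) {c : ℕ} (hc : c ≤ N.toNat) :
    ENNReal.ofReal (Real.sqrt (Real.log (2 * c))) ≤ sqrtLogTwoMul N := by
  have h := sqrtLogTwoMul_mono (a := (c : ℕ∞)) (b := N)
    (by rw [← ENat.natCast_toNat hN]; exact_mod_cast hc)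
  simpa [sqrtLogTwoMul] using h

/-- A dyadic lower sum of the integral of a decreasing function. -/
lemma sum_dyadic_le_lintegral {φ : ℝ → ℝ≥0∞} (hφ : AntitoneOn φ (Set.Ioi 0)) (K : ℕ) :
    ∑ k ∈ Finset.range K, ENNReal.ofReal ((1 / 2) ^ (k + 2)) * φ ((1 / 2) ^ (k + 1)) ≤
      ∫⁻ ε in Set.Ioc 0 (1 / 2), φ ε := by
  suffices h : ∑ k ∈ Finset.range K, ENNReal.ofReal ((1 / 2) ^ (k + 2)) * φ ((1 / 2) ^ (k + 1)) +
      ∫⁻ ε in Set.Ioc 0 ((1 / 2) ^ (K + 1)), φ ε ≤ ∫⁻ ε in Set.Ioc 0 (1 / 2), φ ε from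
    le_self_add.trans h
  induction K with
  | zero => simp
  | succ K ih =>
    refine le_trans ?_ ih
    have hpos : (0 : ℝ) < (1 / 2) ^ (K + 2) := by positivity
    have hhalf : (1 / 2 : ℝ) ^ (K + 1) = 2 * (1 / 2) ^ (K + 2) := by ring
    have hle : (1 / 2 : ℝ) ^ (K + 2) ≤ (1 / 2) ^ (K + 1) := by linarith
    rw [Finset.sum_range_succ, add_assoc, ← Set.Ioc_union_Ioc_eq_Ioc hpos.le hle,
      lintegral_union measurableSet_Ioc (Set.Ioc_disjoint_Ioc_of_le le_rfl),
      add_comm (∫⁻ ε in Set.Ioc 0 ((1 / 2 : ℝ) ^ (K + 2)), φ ε)]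
    gcongr
    calc ENNReal.ofReal ((1 / 2) ^ (K + 2)) * φ ((1 / 2) ^ (K + 1))
        = ∫⁻ _ε in Set.Ioc ((1 / 2 : ℝ) ^ (K + 2)) ((1 / 2) ^ (K + 1)),
            φ ((1 / 2) ^ (K + 1)) := by
          rw [setLIntegral_const, Real.volume_Ioc, mul_comm]
          congr 2
          linarith
      _ ≤ _ := by
          refine setLIntegral_mono' measurableSet_Ioc fun ε hε => ?_
          exact hφ (hpos.trans hε.1) (Set.mem_Ioi.2 (by positivity)) hε.2

lemma sum_dyadic_le_entropyIntegral (F : Set (X → ℝ)) (C : X → ℝ) {Q : Measure X}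
    (hQ : Q ∈ finSuppProb X) (K : ℕ) :
    ∑ k ∈ Finset.range K, ENNReal.ofReal ((1 / 2) ^ (k + 2)) *
      sqrtLogTwoMul (coveringNumber (ENNReal.ofReal ((1 / 2) ^ (k + 1)) * eLpNorm C 2 Q) F Q) ≤
      entropyIntegral F C (1 / 2) := by
  refine (sum_dyadic_le_lintegral (φ := fun ε =>
    sqrtLogTwoMul (coveringNumber (ENNReal.ofReal ε * eLpNorm C 2 Q) F Q)) ?_ K).trans ?_
  · intro x _ y _ hxy
    exact sqrtLogTwoMul_mono (coveringNumber_anti F Q (by gcongr))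
  · exact lintegral_mono fun ε => le_iSup₂_of_le Q hQ le_rfl

/-! ### The empirical measure -/

/-- The empirical measure `n⁻¹ ∑ j, δ_{z j}` of the sample `z`. -/
noncomputable def empiricalMeasure {n : ℕ} (z : Fin n → X) : Measure X :=
  (n : ℝ≥0∞)⁻¹ • ∑ j, Measure.dirac (z j)

variable [MeasurableSingletonClass X] {n : ℕ}

lemma empiricalMeasure_mem_finSuppProb (hn : 0 < n) (z : Fin n → X) :
    empiricalMeasure z ∈ finSuppProb X := by
  have hn0 : (n : ℝ≥0∞) ≠ 0 := by exact_mod_cast hn.ne'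
  refine ⟨⟨?_⟩, ?_⟩
  · simp [empiricalMeasure, ENNReal.inv_mul_cancel hn0 (ENNReal.natCast_ne_top n)]
  · classical
    refine ⟨Finset.univ.image z, ?_⟩
    simp [empiricalMeasure, Measure.dirac_apply]

lemma eLpNorm_empiricalMeasure (hn : 0 < n) (f : X → ℝ) (z : Fin n → X) :
    eLpNorm f 2 (empiricalMeasure z) = ENNReal.ofReal (empiricalNorm f z) := by
  have hn' : (0 : ℝ) < n := by exact_mod_cast hn
  rw [eLpNorm_eq_lintegral_rpow_enorm_toReal (by simp) (by simp), empiricalMeasure,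
    lintegral_smul_measure, lintegral_finsetSum_measure]
  simp only [lintegral_dirac, ENNReal.toReal_ofNat, smul_eq_mul]
  rw [empiricalNorm, Real.sqrt_eq_rpow,
    ← ENNReal.ofReal_rpow_of_nonneg (by positivity) (by norm_num),
    div_eq_inv_mul (∑ j, f (z j) ^ 2), ENNReal.ofReal_mul (by positivity),
    ENNReal.ofReal_inv_of_pos hn',
    ENNReal.ofReal_natCast, ENNReal.ofReal_sum_of_nonneg fun j _ => sq_nonneg _]
  congr 2
  refine Finset.sum_congr rfl fun j _ => ?_
  rw [Real.enorm_eq_ofReal_abs, ENNReal.ofReal_rpow_of_nonneg (abs_nonneg _) (by norm_num)]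
  congr 1
  norm_num

/-! ### The entropy bound for the Rademacher process on a fixed sample -/

/-- On a fixed sample the nets of radii `2⁻ᵏ ‖C‖`, `k ≥ 1`, together with the net `{0}` of radius
`‖C‖`, are chained. What is left after `K` steps is at most `n 2⁻ᴷ ‖C‖` for every sign vector,
by the Cauchy–Schwarz inequality, so that no finite approximation of `F` is needed. -/
theorem sum_iSup_enorm_signedSum_le (hn : 0 < n) {F : Set (X → ℝ)} {C : X → ℝ}
    (hC : ∀ x, 0 < C x) (hFC : ∀ f ∈ F, ∀ x, |f x| ≤ C x) (hF : F.Nonempty) (z : Fin n → X) :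
    ∑ s : Fin n → Bool, ⨆ f ∈ F, ‖signedSum s (fun j => f (z j))‖ₑ ≤
      Fintype.card (Fin n → Bool) * (ENNReal.ofReal (4 * Real.sqrt 2) *
        ENNReal.ofReal (Real.sqrt n * empiricalNorm C z) * entropyIntegral F C (1 / 2)) := by
  classical
  have hn' : (0 : ℝ) < n := by exact_mod_cast hn
  have : Nonempty (Fin n) := ⟨⟨0, hn⟩⟩
  set Q := empiricalMeasure z with hQdef
  set c := empiricalNorm C z with hc
  have hcpos : 0 < c := Real.sqrt_pos.2 (div_pos
    (Finset.sum_pos (fun j _ => pow_pos (hC _) 2) Finset.univ_nonempty) hn')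
  set r := Real.sqrt n * c with hr
  have hrpos : 0 < r := by positivity
  have hrsq : r ^ 2 = n * c ^ 2 := by rw [hr, mul_pow, Real.sq_sqrt hn'.le]
  set J := entropyIntegral F C (1 / 2) with hJ
  set N : ℕ → ℕ∞ := fun k =>
    coveringNumber (ENNReal.ofReal ((1 / 2) ^ (k + 1)) * eLpNorm C 2 Q) F Q with hN
  have hsumJ : ∀ K, ∑ k ∈ Finset.range K,
      ENNReal.ofReal ((1 / 2) ^ (k + 2)) * sqrtLogTwoMul (N k) ≤ J := fun K =>
    sum_dyadic_le_entropyIntegral F C (empiricalMeasure_mem_finSuppProb hn z) K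
  by_cases hJtop : J = ⊤
  · rw [hJtop, ENNReal.mul_top, ENNReal.mul_top]
    · exact le_top
    · simp
    · have h1 : 0 < ENNReal.ofReal (4 * Real.sqrt 2) := ENNReal.ofReal_pos.2 (by positivity)
      have h2 : 0 < ENNReal.ofReal r := ENNReal.ofReal_pos.2 hrpos
      exact (ENNReal.mul_pos h1.ne' h2.ne').ne'
  have hNfin : ∀ k, N k ≠ ⊤ := by
    intro k hk
    refine hJtop (top_le_iff.1 ((hsumJ (k + 1)).trans' ?_))
    refine le_trans ?_ (Finset.single_le_sum (fun _ _ => zero_le)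
      (Finset.mem_range.2 (Nat.lt_succ_self k)))
    rw [hk]
    simp [sqrtLogTwoMul]
  choose D hDF hDcov hDcard using fun k => exists_finset_cover (hNfin k)
  -- closeness in `L²(Q)` in terms of the coordinate vectors of the sample
  have hclose : ∀ k, ∀ f ∈ F, ∃ g ∈ D k,
      ∑ j, (f (z j) - g (z j)) ^ 2 ≤ (r * (1 / 2) ^ (k + 1)) ^ 2 := by
    intro k f hf
    obtain ⟨g, hg, hfg⟩ := hDcov k f hf
    refine ⟨g, hg, ?_⟩
    rw [eLpNorm_empiricalMeasure hn, eLpNorm_empiricalMeasure hn,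
      ← ENNReal.ofReal_mul (by positivity), ENNReal.ofReal_le_ofReal_iff (by positivity)] at hfg
    have h := sum_sq_eq_empiricalNorm hn (f - g) z
    simp only [Pi.sub_apply] at h
    rw [h, mul_pow, hrsq]
    have h2 := pow_le_pow_left₀ (empiricalNorm_nonneg _ _) hfg 2
    rw [mul_pow] at h2
    nlinarith
  let T : ℕ → Finset (Fin n → ℝ) := fun k =>
    Nat.casesOn k {0} fun k => (D k).image fun f j => f (z j)
  have hTlink : ∀ k, ∀ a ∈ T (k + 1), ∃ b ∈ T k,
      ∑ j, (a j - b j) ^ 2 ≤ (r * (1 / 2) ^ k) ^ 2 := by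
    intro k a ha
    obtain ⟨f, hf, rfl⟩ := Finset.mem_image.1 ha
    cases k with
    | zero =>
      refine ⟨0, Finset.mem_singleton_self _, ?_⟩
      simp only [Pi.zero_apply, sub_zero, pow_zero, mul_one]
      rw [hrsq, ← sum_sq_eq_empiricalNorm hn]
      gcongr ∑ j, ?_ with j
      exact sq_le_sq' (neg_le_of_abs_le (hFC f (hDF _ hf) _)) (le_of_abs_le (hFC f (hDF _ hf) _))
    | succ k =>
      obtain ⟨g, hg, h⟩ := hclose k f (hDF _ hf)
      exact ⟨fun j => g (z j), Finset.mem_image_of_mem _ hg, h⟩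
  have hTcard : ∀ k, (T (k + 1)).card ≤ (N k).toNat := fun k =>
    Finset.card_image_le.trans (hDcard k)
  set W : ℝ≥0∞ := (Fintype.card (Fin n → Bool) : ℝ≥0∞) with hW
  have hWtop : W ≠ ⊤ := ENNReal.natCast_ne_top _
  have hlevel : ∀ K, ∑ s : Fin n → Bool, ⨆ f ∈ F, ‖signedSum s (fun j => f (z j))‖ₑ ≤
      W * (ENNReal.ofReal (4 * Real.sqrt 2) * ENNReal.ofReal r * J) +
        W * ENNReal.ofReal (Real.sqrt n * (r * (1 / 2) ^ (K + 1))) := by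
    intro K
    have hTne : (T (K + 1)).Nonempty := by
      obtain ⟨f, hf⟩ := hF
      obtain ⟨g, hg, -⟩ := hclose K f hf
      exact ⟨_, Finset.mem_image_of_mem _ hg⟩
    choose a ha hamax using fun s : Fin n → Bool =>
      Finset.exists_max_image (T (K + 1)) (fun a => |signedSum s a|) hTne
    have hchain := sum_le_chaining hrpos (T := T) rfl hTlink (K + 1)
      (M := fun s => |signedSum s (a s)|) fun s => ⟨a s, ha s, le_rfl⟩
    have hsup : ∀ s : Fin n → Bool, ⨆ f ∈ F, ‖signedSum s (fun j => f (z j))‖ₑ ≤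
        ENNReal.ofReal |signedSum s (a s)| +
          ENNReal.ofReal (Real.sqrt n * (r * (1 / 2) ^ (K + 1))) := by
      intro s
      refine iSup₂_le fun f hf => ?_
      obtain ⟨g, hg, hfg⟩ := hclose K f hf
      rw [Real.enorm_eq_ofReal_abs, ← ENNReal.ofReal_add (abs_nonneg _) (by positivity)]
      refine ENNReal.ofReal_le_ofReal ?_
      have h1 := hamax s _ (Finset.mem_image_of_mem (fun (f : X → ℝ) j => f (z j)) hg)
      have h2 := abs_signedSum_le_sqrt s (a := (fun j => f (z j)) - fun j => g (z j))
        (by positivity) hfg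
      rw [signedSum_sub, Fintype.card_fin] at h2
      have h3 := abs_sub_abs_le_abs_sub (signedSum s fun j => f (z j))
        (signedSum s fun j => g (z j))
      linarith
    calc ∑ s : Fin n → Bool, ⨆ f ∈ F, ‖signedSum s (fun j => f (z j))‖ₑ
        ≤ ∑ s : Fin n → Bool, (ENNReal.ofReal |signedSum s (a s)| +
          ENNReal.ofReal (Real.sqrt n * (r * (1 / 2) ^ (K + 1)))) := by
          gcongr with s
          exact hsup s
      _ = ENNReal.ofReal (∑ s : Fin n → Bool, |signedSum s (a s)|) +
          W * ENNReal.ofReal (Real.sqrt n * (r * (1 / 2) ^ (K + 1))) := by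
          rw [Finset.sum_add_distrib, ENNReal.ofReal_sum_of_nonneg fun _ _ => abs_nonneg _,
            Finset.sum_const, nsmul_eq_mul, Finset.card_univ]
      _ ≤ _ := by
          gcongr
          refine (ENNReal.ofReal_le_ofReal hchain).trans ?_
          rw [ENNReal.ofReal_mul (by positivity), ENNReal.ofReal_natCast]
          gcongr
          rw [ENNReal.ofReal_sum_of_nonneg fun k _ => by positivity]
          calc ∑ k ∈ Finset.range (K + 1), ENNReal.ofReal
                (r * (1 / 2) ^ k * Real.sqrt (2 * Real.log (2 * (T (k + 1)).card)))
              ≤ ∑ k ∈ Finset.range (K + 1), ENNReal.ofReal (4 * Real.sqrt 2) * ENNReal.ofReal r *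
                (ENNReal.ofReal ((1 / 2) ^ (k + 2)) * sqrtLogTwoMul (N k)) := by
                gcongr with k
                have h4 : r * (1 / 2) ^ k * Real.sqrt (2 * Real.log (2 * (T (k + 1)).card)) =
                    4 * Real.sqrt 2 * r * ((1 / 2) ^ (k + 2) *
                      Real.sqrt (Real.log (2 * (T (k + 1)).card))) := by
                  rw [Real.sqrt_mul (by norm_num)]
                  ring
                rw [h4, ENNReal.ofReal_mul (by positivity), ENNReal.ofReal_mul (by positivity),
                  ENNReal.ofReal_mul (p := (1 / 2) ^ (k + 2)) (by positivity)]
                gcongr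
                exact ofReal_sqrt_log_le (hNfin k) (hTcard k)
            _ ≤ _ := by
                rw [← Finset.mul_sum]
                gcongr
                exact hsumJ _
  -- let the number of steps tend to infinity
  refine ge_of_tendsto' (f := fun K : ℕ => W * (ENNReal.ofReal (4 * Real.sqrt 2) *
    ENNReal.ofReal r * J) + W * ENNReal.ofReal (Real.sqrt n * (r * (1 / 2) ^ (K + 1))))
    (x := Filter.atTop) ?_ hlevel
  have hreal : Filter.Tendsto (fun K : ℕ => Real.sqrt n * (r * (1 / 2 : ℝ) ^ (K + 1)))
      Filter.atTop (nhds (Real.sqrt n * (r * 0))) := by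
    refine Filter.Tendsto.const_mul _ (Filter.Tendsto.const_mul _ ?_)
    exact (tendsto_pow_atTop_nhds_zero_of_lt_one (by norm_num) (by norm_num)).comp
      (Filter.tendsto_add_atTop_nat 1)
  have h := ENNReal.Tendsto.const_mul (a := W) (ENNReal.tendsto_ofReal hreal) (Or.inr hWtop)
  simpa using h.const_add (W * (ENNReal.ofReal (4 * Real.sqrt 2) * ENNReal.ofReal r * J))

end Covering

/-! ### Symmetrization -/

section Symmetrization

variable {X A : Type*} [MeasurableSpace X] {P : Measure X} [IsProbabilityMeasure P] {n : ℕ}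
  {T : Set A} {g : A → X → ℝ}

lemma measurable_iSup_enorm_signedSum (hT : T.Countable) (hg : ∀ θ ∈ T, Measurable (g θ))
    (s : Fin n → Bool) :
    Measurable fun z : Fin n → X => ⨆ θ ∈ T, ‖signedSum s (fun j => g θ (z j))‖ₑ := by
  refine Measurable.biSup T hT fun θ hθ => Measurable.enorm ?_
  refine Finset.measurable_sum _ fun j _ => Measurable.const_mul ?_ _
  exact (hg θ hθ).comp (measurable_pi_apply j)

/-- The mean is an average over an independent copy of the sample. -/
lemma lintegral_iSup_enorm_centered_le_copy (hg : ∀ θ ∈ T, Integrable (g θ) P) :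
    ∫⁻ z, ⨆ θ ∈ T, ‖∑ j, (g θ (z j) - ∫ x, g θ x ∂P)‖ₑ ∂(Measure.pi fun _ : Fin n => P) ≤
      ∫⁻ z, ∫⁻ z', ⨆ θ ∈ T, ‖∑ j, (g θ (z j) - g θ (z' j))‖ₑ
        ∂(Measure.pi fun _ : Fin n => P) ∂(Measure.pi fun _ : Fin n => P) := by
  refine lintegral_mono fun z => iSup₂_le fun θ hθ => ?_
  have hint : ∀ j : Fin n, Integrable (fun z' : Fin n → X => g θ (z' j))
      (Measure.pi fun _ : Fin n => P) := fun j =>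
    integrable_comp_eval (μ := fun _ : Fin n => P) (hg θ hθ)
  have hmean : ∑ j, (g θ (z j) - ∫ x, g θ x ∂P) =
      ∫ z', ∑ j, (g θ (z j) - g θ (z' j)) ∂(Measure.pi fun _ : Fin n => P) := by
    have hdiff : ∀ j : Fin n, Integrable (fun z' : Fin n → X => g θ (z j) - g θ (z' j))
        (Measure.pi fun _ : Fin n => P) := fun j => (integrable_const _).sub (hint j)
    rw [integral_finsetSum _ fun j _ => hdiff j]
    refine Finset.sum_congr rfl fun j _ => ?_
    rw [integral_sub (integrable_const _) (hint j), integral_const,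
      integral_comp_eval (μ := fun _ : Fin n => P) (hg θ hθ).aestronglyMeasurable]
    simp
  rw [hmean]
  refine (enorm_integral_le_lintegral_enorm _).trans (lintegral_mono fun z' => ?_)
  exact le_iSup₂_of_le θ hθ le_rfl

/-- Exchanging the `j`-th observation and its independent copy, for all `j` with a negative sign,
does not change the joint law. -/
lemma measurePreserving_swap_of_sign (P : Measure X) [SigmaFinite P] (s : Fin n → Bool) :
    MeasurePreserving
      (fun (w : Fin n → X × X) j => (if s j then id else Prod.swap : X × X → X × X) (w j))
      (Measure.pi fun _ => P.prod P) (Measure.pi fun _ => P.prod P) := by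
  refine measurePreserving_pi (fun _ : Fin n => P.prod P) (fun _ : Fin n => P.prod P)
    (f := fun j => (if s j then id else Prod.swap : X × X → X × X)) fun j => ?_
  split_ifs
  · exact MeasurePreserving.id _
  · exact Measure.measurePreserving_swap

/-- Symmetrization, for one fixed sign vector. -/
theorem lintegral_iSup_enorm_centered_le_signedSum (hT : T.Countable)
    (hgm : ∀ θ ∈ T, Measurable (g θ)) (hg : ∀ θ ∈ T, Integrable (g θ) P) (s : Fin n → Bool) :
    ∫⁻ z, ⨆ θ ∈ T, ‖∑ j, (g θ (z j) - ∫ x, g θ x ∂P)‖ₑ ∂(Measure.pi fun _ : Fin n => P) ≤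
      2 * ∫⁻ z, ⨆ θ ∈ T, ‖signedSum s (fun j => g θ (z j))‖ₑ
        ∂(Measure.pi fun _ : Fin n => P) := by
  set S : (Fin n → X) × (Fin n → X) → ℝ≥0∞ :=
    fun p => ⨆ θ ∈ T, ‖∑ j, (g θ (p.1 j) - g θ (p.2 j))‖ₑ with hS
  have hSm : Measurable S := by
    refine Measurable.biSup T hT fun θ hθ => Measurable.enorm ?_
    refine Finset.measurable_sum _ fun j _ => ?_
    have := hgm θ hθ
    fun_prop
  set R : (Fin n → X) → ℝ≥0∞ := fun z => ⨆ θ ∈ T, ‖signedSum s (fun j => g θ (z j))‖ₑ with hR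
  have hRm : Measurable R := measurable_iSup_enorm_signedSum hT hgm s
  have hpair := measurePreserving_arrowProdEquivProdArrow X X (Fin n) (fun _ => P) (fun _ => P)
  have hswap := measurePreserving_swap_of_sign P s
  have hfst : MeasurePreserving (fun (w : Fin n → X × X) j => (w j).1)
      (Measure.pi fun _ => P.prod P) (Measure.pi fun _ => P) :=
    measurePreserving_pi (fun _ : Fin n => P.prod P) (fun _ : Fin n => P)
      (f := fun _ => Prod.fst) fun _ => measurePreserving_fst
  have hsnd : MeasurePreserving (fun (w : Fin n → X × X) j => (w j).2)
      (Measure.pi fun _ => P.prod P) (Measure.pi fun _ => P) :=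
    measurePreserving_pi (fun _ : Fin n => P.prod P) (fun _ : Fin n => P)
      (f := fun _ => Prod.snd) fun _ => measurePreserving_snd
  have hSm' : Measurable fun w : Fin n → X × X =>
      S (MeasurableEquiv.arrowProdEquivProdArrow X X (Fin n) w) :=
    hSm.comp (MeasurableEquiv.measurable _)
  calc _ ≤ ∫⁻ z, ∫⁻ z', S (z, z')
        ∂(Measure.pi fun _ : Fin n => P) ∂(Measure.pi fun _ : Fin n => P) :=
        lintegral_iSup_enorm_centered_le_copy hg
    _ = ∫⁻ p, S p ∂((Measure.pi fun _ : Fin n => P).prod (Measure.pi fun _ : Fin n => P)) :=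
        (lintegral_prod S hSm.aemeasurable).symm
    _ = ∫⁻ w, S (MeasurableEquiv.arrowProdEquivProdArrow X X (Fin n) w)
          ∂(Measure.pi fun _ : Fin n => P.prod P) := (hpair.lintegral_comp hSm).symm
    _ = ∫⁻ w, S (MeasurableEquiv.arrowProdEquivProdArrow X X (Fin n)
            fun j => (if s j then id else Prod.swap : X × X → X × X) (w j))
          ∂(Measure.pi fun _ : Fin n => P.prod P) := (hswap.lintegral_comp hSm').symm
    _ ≤ ∫⁻ w, (R (fun j => (w j).1) + R fun j => (w j).2)
          ∂(Measure.pi fun _ : Fin n => P.prod P) := by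
        refine lintegral_mono fun w => iSup₂_le fun θ hθ => ?_
        have hsign : ∑ j, (g θ ((if s j then id else Prod.swap : X × X → X × X) (w j)).1 -
              g θ ((if s j then id else Prod.swap : X × X → X × X) (w j)).2) =
            signedSum s (fun j => g θ (w j).1) - signedSum s fun j => g θ (w j).2 := by
          rw [signedSum, signedSum, ← Finset.sum_sub_distrib]
          refine Finset.sum_congr rfl fun j _ => ?_
          cases s j <;> simp [boolSign, neg_add_eq_sub]
        change ‖∑ j, (g θ ((if s j then id else Prod.swap : X × X → X × X) (w j)).1 -
              g θ ((if s j then id else Prod.swap : X × X → X × X) (w j)).2)‖ₑ ≤ _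
        rw [hsign]
        exact enorm_sub_le.trans
          (add_le_add (le_iSup₂_of_le θ hθ le_rfl) (le_iSup₂_of_le θ hθ le_rfl))
    _ = 2 * ∫⁻ z, R z ∂(Measure.pi fun _ : Fin n => P) := by
        have hR1 : Measurable fun w : Fin n → X × X => R fun j => (w j).1 :=
          hRm.comp hfst.measurable
        rw [lintegral_add_left hR1, hfst.lintegral_comp hRm,
          hsnd.lintegral_comp hRm, two_mul]

end Symmetrization

/-! ### The maximal inequality for the empirical process -/

section EmpiricalProcess

variable {X A : Type*} [MeasurableSpace X] {P : Measure X} [IsProbabilityMeasure P] {n : ℕ}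

lemma measurable_empiricalNorm {C : X → ℝ} (hC : Measurable C) :
    Measurable (empiricalNorm (n := n) C) := by
  unfold empiricalNorm
  fun_prop

/-- By Jensen's inequality the mean of the empirical `L²` norm is at most the `L²` norm. -/
lemma lintegral_empiricalNorm_le (hn : 0 < n) {C : X → ℝ} (hC : Measurable C) :
    ∫⁻ z, ENNReal.ofReal (empiricalNorm C z) ∂(Measure.pi fun _ : Fin n => P) ≤
      eLpNorm C 2 P := by
  have hn' : (0 : ℝ) < n := by exact_mod_cast hn
  have hn0 : (n : ℝ≥0∞) ≠ 0 := by exact_mod_cast hn.ne'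
  have hm := measurable_empiricalNorm (n := n) hC
  have hsq : ∀ z : Fin n → X, ‖empiricalNorm C z‖ₑ ^ (2 : ℝ) =
      (n : ℝ≥0∞)⁻¹ * ∑ j, ‖C (z j)‖ₑ ^ (2 : ℝ) := by
    intro z
    have hrpow : ∀ x : ℝ, ‖x‖ₑ ^ (2 : ℝ) = ENNReal.ofReal (x ^ 2) := by
      intro x
      rw [Real.enorm_eq_ofReal_abs, ENNReal.ofReal_rpow_of_nonneg (abs_nonneg _) (by norm_num)]
      congr 1
      norm_num
    simp only [hrpow]
    rw [← ENNReal.ofReal_sum_of_nonneg fun j _ => sq_nonneg _, sum_sq_eq_empiricalNorm hn,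
      ENNReal.ofReal_mul hn'.le, ENNReal.ofReal_natCast, ← mul_assoc,
      ENNReal.inv_mul_cancel hn0 (ENNReal.natCast_ne_top n), one_mul]
  calc ∫⁻ z, ENNReal.ofReal (empiricalNorm C z) ∂(Measure.pi fun _ : Fin n => P)
      = eLpNorm (empiricalNorm C) 1 (Measure.pi fun _ : Fin n => P) := by
        rw [eLpNorm_one_eq_lintegral_enorm]
        refine lintegral_congr fun z => ?_
        rw [Real.enorm_eq_ofReal_abs, abs_of_nonneg (empiricalNorm_nonneg _ _)]
    _ ≤ eLpNorm (empiricalNorm C) 2 (Measure.pi fun _ : Fin n => P) :=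
        eLpNorm_le_eLpNorm_of_exponent_le (by norm_num) hm.aestronglyMeasurable
    _ = eLpNorm C 2 P := by
        rw [eLpNorm_eq_lintegral_rpow_enorm_toReal (by simp) (by simp),
          eLpNorm_eq_lintegral_rpow_enorm_toReal (by simp) (by simp)]
        simp only [ENNReal.toReal_ofNat, hsq]
        have hterm : Measurable fun x => ‖C x‖ₑ ^ (2 : ℝ) := by fun_prop
        rw [lintegral_const_mul _ (by fun_prop), lintegral_finsetSum _ fun j _ => by fun_prop]
        have heval : ∀ j : Fin n, ∫⁻ z : Fin n → X, ‖C (z j)‖ₑ ^ (2 : ℝ)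
            ∂(Measure.pi fun _ : Fin n => P) = ∫⁻ x, ‖C x‖ₑ ^ (2 : ℝ) ∂P := fun j =>
          (measurePreserving_eval (fun _ : Fin n => P) j).lintegral_comp hterm
        simp only [heval, Finset.sum_const, Finset.card_univ, Fintype.card_fin, nsmul_eq_mul]
        rw [← mul_assoc, ENNReal.inv_mul_cancel hn0 (ENNReal.natCast_ne_top n), one_mul]

variable [MeasurableSingletonClass X]

/-- The uniform entropy bound for a countable subfamily, with the constant `8 √2`. -/
theorem lintegral_iSup_enorm_centered_le_entropyIntegral (hn : 0 < n) {S T : Set A}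
    {g : A → X → ℝ} {C : X → ℝ} (hTS : T ⊆ S) (hT : T.Countable) (hS : S.Nonempty)
    (hgm : ∀ θ ∈ T, Measurable (g θ)) (hg : ∀ θ ∈ T, Integrable (g θ) P) (hCm : Measurable C)
    (hC : ∀ x, 0 < C x) (hgC : ∀ x, ∀ θ ∈ S, |g θ x| ≤ C x) :
    ∫⁻ z, ⨆ θ ∈ T, ‖∑ j, (g θ (z j) - ∫ x, g θ x ∂P)‖ₑ ∂(Measure.pi fun _ : Fin n => P) ≤
      ENNReal.ofReal (8 * Real.sqrt 2) * ENNReal.ofReal (Real.sqrt n) * eLpNorm C 2 P *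
        entropyIntegral (g '' S) C (1 / 2) := by
  set J := entropyIntegral (g '' S) C (1 / 2) with hJ
  set I := ∫⁻ z, ⨆ θ ∈ T, ‖∑ j, (g θ (z j) - ∫ x, g θ x ∂P)‖ₑ
    ∂(Measure.pi fun _ : Fin n => P) with hI
  set W : ℝ≥0∞ := (Fintype.card (Fin n → Bool) : ℝ≥0∞) with hW
  have hW0 : W ≠ 0 := by
    rw [hW]
    exact_mod_cast (Fintype.card_pos (α := Fin n → Bool)).ne'
  have hWtop : W ≠ ⊤ := ENNReal.natCast_ne_top _
  have hcm := measurable_empiricalNorm (n := n) hCm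
  have key : W * I ≤ W * (ENNReal.ofReal (8 * Real.sqrt 2) * ENNReal.ofReal (Real.sqrt n) *
      eLpNorm C 2 P * J) := by
    calc W * I = ∑ _s : Fin n → Bool, I := by
          rw [Finset.sum_const, nsmul_eq_mul, Finset.card_univ]
      _ ≤ ∑ s : Fin n → Bool, 2 * ∫⁻ z, ⨆ θ ∈ T, ‖signedSum s (fun j => g θ (z j))‖ₑ
            ∂(Measure.pi fun _ : Fin n => P) := by
          gcongr with s
          exact lintegral_iSup_enorm_centered_le_signedSum hT hgm hg s
      _ = 2 * ∫⁻ z, ∑ s : Fin n → Bool, ⨆ θ ∈ T, ‖signedSum s (fun j => g θ (z j))‖ₑ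
            ∂(Measure.pi fun _ : Fin n => P) := by
          rw [← Finset.mul_sum, lintegral_finsetSum _ fun s _ =>
            measurable_iSup_enorm_signedSum hT hgm s]
      _ ≤ 2 * ∫⁻ z, W * (ENNReal.ofReal (4 * Real.sqrt 2) *
            ENNReal.ofReal (Real.sqrt n * empiricalNorm C z) * J)
            ∂(Measure.pi fun _ : Fin n => P) := by
          gcongr with z
          refine le_trans ?_ (sum_iSup_enorm_signedSum_le hn hC (F := g '' S)
            (by rintro _ ⟨θ, hθ, rfl⟩ x; exact hgC x θ hθ) (hS.image g) z)
          gcongr with s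
          refine iSup₂_le fun θ hθ => ?_
          exact le_iSup₂_of_le (g θ) (Set.mem_image_of_mem g (hTS hθ)) le_rfl
      _ = W * (2 * ENNReal.ofReal (4 * Real.sqrt 2) * ENNReal.ofReal (Real.sqrt n) *
            (∫⁻ z, ENNReal.ofReal (empiricalNorm C z) ∂(Measure.pi fun _ : Fin n => P)) * J) := by
          simp only [ENNReal.ofReal_mul (Real.sqrt_nonneg (n : ℝ))]
          rw [lintegral_const_mul _ (by fun_prop), lintegral_mul_const _ (by fun_prop),
            lintegral_const_mul _ (by fun_prop), lintegral_const_mul _ (by fun_prop)]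
          ring
      _ ≤ _ := by
          have h8 : ENNReal.ofReal (8 * Real.sqrt 2) = 2 * ENNReal.ofReal (4 * Real.sqrt 2) := by
            rw [← ENNReal.ofReal_ofNat 2, ← ENNReal.ofReal_mul (by norm_num)]
            congr 1
            ring
          rw [h8]
          gcongr
          exact lintegral_empiricalNorm_le hn hCm
  exact (ENNReal.mul_le_mul_iff_right hW0 hWtop).1 key

end EmpiricalProcess

/-! ### Optimal values and deviations -/

section OptimalValue

variable {A : Type*} {S T : Set A} {a : A → ℝ}

/-- A subset along which every value can be approached has the same infimum. -/
lemma iInf_subtype_eq_of_approx (hTS : T ⊆ S) (hT : T.Nonempty)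
    (ha : BddBelow (Set.range fun θ : S => a θ))
    (happ : ∀ θ ∈ S, ∀ ε > 0, ∃ ϑ ∈ T, a ϑ ≤ a θ + ε) :
    ⨅ θ : S, a θ = ⨅ θ : T, a θ := by
  have : Nonempty T := hT.to_subtype
  have : Nonempty S := (hT.mono hTS).to_subtype
  have haT : BddBelow (Set.range fun θ : T => a θ) := by
    refine ha.mono ?_
    rintro _ ⟨θ, rfl⟩
    exact ⟨⟨θ, hTS θ.2⟩, rfl⟩
  refine le_antisymm (le_ciInf fun θ => ciInf_le ha ⟨θ, hTS θ.2⟩) (le_ciInf fun θ => ?_)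
  refine le_of_forall_pos_le_add fun ε hε => ?_
  obtain ⟨ϑ, hϑ, h⟩ := happ θ θ.2 ε hε
  exact (ciInf_le haT ⟨ϑ, hϑ⟩).trans h

lemma abs_iInf_sub_iInf_le {B : Type*} [Nonempty B] {a b : B → ℝ}
    (ha : BddBelow (Set.range a)) (hb : BddBelow (Set.range b))
    (hab : BddAbove (Set.range fun θ => |a θ - b θ|)) :
    |(⨅ θ, a θ) - ⨅ θ, b θ| ≤ ⨆ θ, |a θ - b θ| := by
  have h : ∀ θ, |a θ - b θ| ≤ ⨆ θ, |a θ - b θ| := le_ciSup hab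
  rw [abs_sub_le_iff]
  constructor <;> rw [sub_le_iff_le_add, ← sub_le_iff_le_add'] <;> refine le_ciInf fun θ => ?_
  · linarith [ciInf_le ha θ, (abs_le.1 (h θ)).2]
  · linarith [ciInf_le hb θ, (abs_le.1 (h θ)).1]

end OptimalValue

section Deviation

variable {m d : ℕ} {Ω : Type*} {Θ Θ' : Set (EuclideanSpace ℝ (Fin m))}
  {G : EuclideanSpace ℝ (Fin m) → EuclideanSpace ℝ (Fin d) → ℝ}
  {P : Measure (EuclideanSpace ℝ (Fin d))} {Z : ℕ → Ω → EuclideanSpace ℝ (Fin d)}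
  {ξ : EuclideanSpace ℝ (Fin d) → ℝ} {n : ℕ}

lemma sampleAverage_sub_mean_eq (hn : 0 < n) (h : EuclideanSpace ℝ (Fin d) → ℝ) (c : ℝ) (ω : Ω) :
    sampleAverage Z n h ω - c = (1 / (n : ℝ)) * ∑ j : Fin n, (h (Z j ω) - c) := by
  have hn' : (n : ℝ) ≠ 0 := by exact_mod_cast hn.ne'
  rw [sampleAverage, Finset.sum_range, Finset.sum_sub_distrib, Finset.sum_const, Finset.card_univ,
    Fintype.card_fin, nsmul_eq_mul]
  field_simp

lemma abs_sampleAverage_le {h : EuclideanSpace ℝ (Fin d) → ℝ} (hh : ∀ z, |h z| ≤ ξ z) (ω : Ω) :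
    |sampleAverage Z n h ω| ≤ sampleAverage Z n ξ ω := by
  rw [sampleAverage, abs_mul, abs_of_nonneg (by positivity : (0 : ℝ) ≤ 1 / n), sampleAverage]
  gcongr
  exact (Finset.abs_sum_le_sum_abs _ _).trans (Finset.sum_le_sum fun j _ => hh _)

lemma sampleAverage_le_add (hn : 0 < n) {h k : EuclideanSpace ℝ (Fin d) → ℝ} {ε : ℝ} {ω : Ω}
    (hhk : ∀ j : Fin n, h (Z j ω) ≤ k (Z j ω) + ε) :
    sampleAverage Z n h ω ≤ sampleAverage Z n k ω + ε := by
  have hn' : (n : ℝ) ≠ 0 := by exact_mod_cast hn.ne'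
  have h1 : ∑ j : Fin n, h (Z j ω) ≤ ∑ j : Fin n, (k (Z j ω) + ε) :=
    Finset.sum_le_sum fun j _ => hhk j
  calc sampleAverage Z n h ω ≤ (1 / (n : ℝ)) * ∑ j : Fin n, (k (Z j ω) + ε) := by
        rw [sampleAverage, Finset.sum_range]
        gcongr
    _ = sampleAverage Z n k ω + ε := by
        rw [sampleAverage, Finset.sum_range, Finset.sum_add_distrib, Finset.sum_const,
          Finset.card_univ, Fintype.card_fin, nsmul_eq_mul]
        field_simp

lemma IsPositiveIntegrableEnvelope.integrable_goal (hξ : IsPositiveIntegrableEnvelope Θ G P ξ)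
    (hG : MeasurableGoals Θ G) {θ : EuclideanSpace ℝ (Fin m)} (hθ : θ ∈ Θ) :
    Integrable (G θ) P :=
  hξ.integrable.mono' (hG θ hθ).aestronglyMeasurable
    (Filter.Eventually.of_forall fun z => hξ.bound z θ hθ)

lemma IsPositiveIntegrableEnvelope.abs_mean_le (hξ : IsPositiveIntegrableEnvelope Θ G P ξ)
    {θ : EuclideanSpace ℝ (Fin m)} (hθ : θ ∈ Θ) :
    |∫ z, G θ z ∂P| ≤ ∫ z, ξ z ∂P :=
  norm_integral_le_of_norm_le (f := G θ) hξ.integrable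
    (Filter.Eventually.of_forall fun z => hξ.bound z θ hθ)

lemma IsPositiveIntegrableEnvelope.abs_deviation_le (hξ : IsPositiveIntegrableEnvelope Θ G P ξ)
    {θ : EuclideanSpace ℝ (Fin m)} (hθ : θ ∈ Θ) (ω : Ω) :
    |sampleAverage Z n (G θ) ω - ∫ z, G θ z ∂P| ≤ sampleAverage Z n ξ ω + ∫ z, ξ z ∂P :=
  (abs_sub _ _).trans (add_le_add (abs_sampleAverage_le (fun z => hξ.bound z θ hθ) ω)
    (hξ.abs_mean_le hθ))

lemma IsPositiveIntegrableEnvelope.bddAbove_deviation (hξ : IsPositiveIntegrableEnvelope Θ G P ξ)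
    (hΘ' : Θ' ⊆ Θ) (ω : Ω) :
    BddAbove (Set.range fun θ : Θ' => |sampleAverage Z n (G θ) ω - ∫ z, G θ z ∂P|) :=
  ⟨_, Set.forall_mem_range.2 fun θ => hξ.abs_deviation_le (hΘ' θ.2) ω⟩

lemma IsPositiveIntegrableEnvelope.bddBelow_sampleAverage
    (hξ : IsPositiveIntegrableEnvelope Θ G P ξ) (hΘ' : Θ' ⊆ Θ) (ω : Ω) :
    BddBelow (Set.range fun θ : Θ' => sampleAverage Z n (G θ) ω) :=
  ⟨_, Set.forall_mem_range.2 fun θ =>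
    (abs_le.1 (abs_sampleAverage_le (fun z => hξ.bound z θ (hΘ' θ.2)) ω)).1⟩

lemma IsPositiveIntegrableEnvelope.bddBelow_mean
    (hξ : IsPositiveIntegrableEnvelope Θ G P ξ) (hΘ' : Θ' ⊆ Θ) :
    BddBelow (Set.range fun θ : Θ' => ∫ z, G θ z ∂P) :=
  ⟨_, Set.forall_mem_range.2 fun θ => (abs_le.1 (hξ.abs_mean_le (hΘ' θ.2))).1⟩

lemma IsApproximatingSubset.nonempty (h : IsApproximatingSubset Θ G P Θ') (hΘ : Θ.Nonempty) :
    Θ'.Nonempty := by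
  obtain ⟨θ, hθ⟩ := hΘ
  by_contra hne
  have := h.approx_mean θ hθ
  simp [Set.not_nonempty_iff_eq_empty.1 hne] at this

lemma IsApproximatingSubset.iInf_mean_eq (h : IsApproximatingSubset Θ G P Θ')
    (hξ : IsPositiveIntegrableEnvelope Θ G P ξ) (hΘ : Θ.Nonempty) :
    ⨅ θ : Θ, ∫ z, G θ z ∂P = ⨅ θ : Θ', ∫ z, G θ z ∂P := by
  refine iInf_subtype_eq_of_approx (a := fun θ => ∫ z, G θ z ∂P) h.subset (h.nonempty hΘ)
    (hξ.bddBelow_mean subset_rfl) fun θ hθ ε hε => ?_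
  have h0 : ⨅ ϑ ∈ Θ', ENNReal.ofReal |∫ z, G ϑ z ∂P - ∫ z, G θ z ∂P| < ENNReal.ofReal ε := by
    rw [h.approx_mean θ hθ]
    exact ENNReal.ofReal_pos.2 hε
  simp only [iInf_lt_iff] at h0
  obtain ⟨ϑ, hϑ, hlt⟩ := h0
  refine ⟨ϑ, hϑ, ?_⟩
  have := (ENNReal.ofReal_lt_ofReal_iff hε).1 hlt
  linarith [(abs_lt.1 this).2]

lemma ae_iInf_sampleAverage_eq [MeasurableSpace Ω] {μ : Measure Ω} (hZ : ∀ j, Measurable (Z j))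
    (hlaw : μ.map (fun ω (j : Fin n) => Z j ω) = Measure.pi fun _ : Fin n => P)
    (h : IsApproximatingSubset Θ G P Θ') (hξ : IsPositiveIntegrableEnvelope Θ G P ξ)
    (hΘ : Θ.Nonempty) (hn : 0 < n) :
    ∀ᵐ ω ∂μ, ⨅ θ : Θ, sampleAverage Z n (G θ) ω = ⨅ θ : Θ', sampleAverage Z n (G θ) ω := by
  obtain ⟨N, hN, happ⟩ := h.approx_sample n hn
  have hmeas : Measurable fun ω (j : Fin n) => Z j ω := measurable_pi_lambda _ fun j => hZ j
  have hae : ∀ᵐ ω ∂μ, (fun j : Fin n => Z j ω) ∉ N := by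
    refine ae_of_ae_map (p := fun z => z ∉ N) hmeas.aemeasurable ?_
    rw [hlaw]
    exact measure_eq_zero_iff_ae_notMem.1 hN
  filter_upwards [hae] with ω hω
  refine iInf_subtype_eq_of_approx (a := fun θ => sampleAverage Z n (G θ) ω) h.subset
    (h.nonempty hΘ) (hξ.bddBelow_sampleAverage subset_rfl ω) fun θ hθ ε hε => ?_
  have h0 : ⨅ ϑ ∈ Θ', ⨆ j : Fin n, ENNReal.ofReal |G θ (Z j ω) - G ϑ (Z j ω)| <
      ENNReal.ofReal ε := by
    rw [happ θ hθ _ hω]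
    exact ENNReal.ofReal_pos.2 hε
  simp only [iInf_lt_iff] at h0
  obtain ⟨ϑ, hϑ, hlt⟩ := h0
  refine ⟨ϑ, hϑ, sampleAverage_le_add hn fun j => ?_⟩
  have := (ENNReal.ofReal_lt_ofReal_iff hε).1
    ((le_iSup (fun j : Fin n => ENNReal.ofReal |G θ (Z j ω) - G ϑ (Z j ω)|) j).trans_lt hlt)
  linarith [(abs_lt.1 this).1]

lemma measurable_sampleAverage [MeasurableSpace Ω] (hZ : ∀ j, Measurable (Z j))
    {h : EuclideanSpace ℝ (Fin d) → ℝ} (hh : Measurable h) :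
    Measurable (sampleAverage Z n h) := by
  unfold sampleAverage
  exact (Finset.measurable_sum _ fun j _ => hh.comp (hZ j)).const_mul _

lemma integrable_sampleAverage [MeasurableSpace Ω] {μ : Measure Ω} (hZ : ∀ j, Measurable (Z j))
    (hZlaw : ∀ j, μ.map (Z j) = P) {h : EuclideanSpace ℝ (Fin d) → ℝ} (hh : Integrable h P) :
    Integrable (sampleAverage Z n h) μ := by
  unfold sampleAverage
  refine (integrable_finsetSum _ fun j _ => ?_).const_mul _
  exact Integrable.comp_measurable (by rwa [hZlaw j]) (hZ j)

lemma integrable_supDeviation [MeasurableSpace Ω] {μ : Measure Ω} [IsFiniteMeasure μ]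
    (hZ : ∀ j, Measurable (Z j)) (hZlaw : ∀ j, μ.map (Z j) = P)
    (hG : MeasurableGoals Θ G) (h : IsApproximatingSubset Θ G P Θ')
    (hξ : IsPositiveIntegrableEnvelope Θ G P ξ) (hΘ : Θ.Nonempty) :
    Integrable (supDeviation Θ' G P Z n) μ := by
  have : Countable Θ' := h.countable.to_subtype
  have : Nonempty Θ' := (h.nonempty hΘ).to_subtype
  refine Integrable.mono' (g := fun ω => sampleAverage Z n ξ ω + ∫ z, ξ z ∂P)
    ((integrable_sampleAverage hZ hZlaw hξ.integrable).add (integrable_const _)) ?_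
    (Filter.Eventually.of_forall fun ω => ?_)
  · refine (Measurable.iSup fun θ : Θ' => ?_).aestronglyMeasurable
    have := (measurable_sampleAverage (n := n) hZ (hG θ (h.subset θ.2))).sub_const
      (∫ z, G θ z ∂P)
    exact this.abs
  · rw [supDeviation, Real.norm_of_nonneg (Real.iSup_nonneg fun _ => abs_nonneg _)]
    exact ciSup_le fun θ => hξ.abs_deviation_le (h.subset θ.2) ω

lemma aestronglyMeasurable_optimalValueError [MeasurableSpace Ω] {μ : Measure Ω}
    (hZ : ∀ j, Measurable (Z j)) (hG : MeasurableGoals Θ G) (h : IsApproximatingSubset Θ G P Θ')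
    (hae : ∀ᵐ ω ∂μ,
      ⨅ θ : Θ, sampleAverage Z n (G θ) ω = ⨅ θ : Θ', sampleAverage Z n (G θ) ω) :
    AEStronglyMeasurable (optimalValueError Θ G P Z n) μ := by
  have : Countable Θ' := h.countable.to_subtype
  have hm : Measurable fun ω =>
      |(⨅ θ : Θ', sampleAverage Z n (G θ) ω) - ⨅ θ : Θ, ∫ z, G θ z ∂P| := by
    have := (Measurable.iInf fun θ : Θ' =>
      measurable_sampleAverage (n := n) hZ (hG θ (h.subset θ.2))).sub_const
        (⨅ θ : Θ, ∫ z, G θ z ∂P)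
    exact this.abs
  refine hm.aestronglyMeasurable.congr ?_
  filter_upwards [hae] with ω hω
  rw [optimalValueError, hω]

lemma ae_optimalValueError_le_supDeviation [MeasurableSpace Ω] {μ : Measure Ω}
    (h : IsApproximatingSubset Θ G P Θ') (hξ : IsPositiveIntegrableEnvelope Θ G P ξ)
    (hΘ : Θ.Nonempty) (hae : ∀ᵐ ω ∂μ,
      ⨅ θ : Θ, sampleAverage Z n (G θ) ω = ⨅ θ : Θ', sampleAverage Z n (G θ) ω) :
    ∀ᵐ ω ∂μ, optimalValueError Θ G P Z n ω ≤ supDeviation Θ' G P Z n ω := by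
  have : Nonempty Θ' := (h.nonempty hΘ).to_subtype
  filter_upwards [hae] with ω hω
  rw [optimalValueError, hω, h.iInf_mean_eq hξ hΘ]
  exact abs_iInf_sub_iInf_le (hξ.bddBelow_sampleAverage h.subset ω)
    (hξ.bddBelow_mean h.subset) (hξ.bddAbove_deviation h.subset ω)

lemma ofReal_supDeviation_eq (h : IsApproximatingSubset Θ G P Θ')
    (hξ : IsPositiveIntegrableEnvelope Θ G P ξ) (hΘ : Θ.Nonempty) (hn : 0 < n) (ω : Ω) :
    ENNReal.ofReal (supDeviation Θ' G P Z n ω) = ENNReal.ofReal (1 / n) *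
      ⨆ θ ∈ Θ', ‖∑ j : Fin n, (G θ (Z j ω) - ∫ z, G θ z ∂P)‖ₑ := by
  have : Nonempty Θ' := (h.nonempty hΘ).to_subtype
  rw [supDeviation, Monotone.map_ciSup_of_continuousAt ENNReal.continuous_ofReal.continuousAt
    ENNReal.ofReal_mono (hξ.bddAbove_deviation h.subset ω), iSup_subtype']
  rw [ENNReal.mul_iSup]
  refine iSup_congr fun θ => ?_
  rw [sampleAverage_sub_mean_eq hn, abs_mul, abs_of_nonneg (by positivity : (0 : ℝ) ≤ 1 / n),
    ENNReal.ofReal_mul (by positivity), Real.enorm_eq_ofReal_abs]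

lemma map_sample_eq_pi [MeasurableSpace Ω] {μ : Measure Ω} [IsProbabilityMeasure μ]
    (hZ : ∀ j, Measurable (Z j)) (hZindep : iIndepFun Z μ) (hZlaw : ∀ j, μ.map (Z j) = P) (n : ℕ) :
    μ.map (fun ω (j : Fin n) => Z j ω) = Measure.pi fun _ : Fin n => P := by
  have h := (iIndepFun_iff_map_fun_eq_pi_map
    (f := fun j : Fin n => Z j) fun j => (hZ j).aemeasurable).1
    (hZindep.precomp (g := fun j : Fin n => (j : ℕ)) Fin.val_injective)
  simpa only [hZlaw] using h

/-- The mean of the supremum of the deviations is an integral over the sample space. -/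
lemma ofReal_integral_supDeviation_eq [MeasurableSpace Ω] {μ : Measure Ω}
    [IsProbabilityMeasure μ] (hZ : ∀ j, Measurable (Z j)) (hZindep : iIndepFun Z μ)
    (hZlaw : ∀ j, μ.map (Z j) = P) (hG : MeasurableGoals Θ G)
    (h : IsApproximatingSubset Θ G P Θ') (hξ : IsPositiveIntegrableEnvelope Θ G P ξ)
    (hΘ : Θ.Nonempty) (hn : 0 < n) :
    ENNReal.ofReal (∫ ω, supDeviation Θ' G P Z n ω ∂μ) = ENNReal.ofReal (1 / n) *
      ∫⁻ z, ⨆ θ ∈ Θ', ‖∑ j, (G θ (z j) - ∫ x, G θ x ∂P)‖ₑ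
        ∂(Measure.pi fun _ : Fin n => P) := by
  have hm : Measurable fun z : Fin n → EuclideanSpace ℝ (Fin d) =>
      ⨆ θ ∈ Θ', ‖∑ j, (G θ (z j) - ∫ x, G θ x ∂P)‖ₑ := by
    refine Measurable.biSup Θ' h.countable fun θ hθ => Measurable.enorm ?_
    exact Finset.measurable_sum _ fun j _ =>
      ((hG θ (h.subset hθ)).comp (measurable_pi_apply j)).sub_const _
  have hsample : Measurable fun ω (j : Fin n) => Z j ω := measurable_pi_lambda _ fun j => hZ j
  have hm' : Measurable fun ω => ⨆ θ ∈ Θ', ‖∑ j : Fin n, (G θ (Z j ω) - ∫ x, G θ x ∂P)‖ₑ :=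
    hm.comp hsample
  rw [ofReal_integral_eq_lintegral_ofReal (integrable_supDeviation hZ hZlaw hG h hξ hΘ)
    (Filter.Eventually.of_forall fun ω => Real.iSup_nonneg fun _ => abs_nonneg _),
    ← map_sample_eq_pi hZ hZindep hZlaw n,
    lintegral_map hm hsample, ← lintegral_const_mul _ hm']
  exact lintegral_congr fun ω => ofReal_supDeviation_eq h hξ hΘ hn ω

end Deviation

end SAA

theorem theorem1 {m d : ℕ} {Ω : Type*} [MeasurableSpace Ω] (μ : Measure Ω)
    [IsProbabilityMeasure μ]
    (Θ : Set (EuclideanSpace ℝ (Fin m))) (hΘ : Θ.Nonempty) (hΘc : IsCompact Θ)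
    (G : EuclideanSpace ℝ (Fin m) → EuclideanSpace ℝ (Fin d) → ℝ)
    (P : Measure (EuclideanSpace ℝ (Fin d)))
    (Z : ℕ → Ω → EuclideanSpace ℝ (Fin d)) (hZ : ∀ j, Measurable (Z j))
    (hZindep : iIndepFun Z μ) (hZlaw : ∀ j, μ.map (Z j) = P)
    (ξ : EuclideanSpace ℝ (Fin d) → ℝ)
    (hA1 : SAA.MeasurableGoals Θ G)
    (hA2 : SAA.IsPositiveIntegrableEnvelope Θ G P ξ)
    (Θ' : Set (EuclideanSpace ℝ (Fin m)))
    (hA3 : SAA.IsApproximatingSubset Θ G P Θ')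
    (hξ : MemLp ξ 2 P) (n : ℕ) (hn : 0 < n) :
    Integrable (SAA.optimalValueError Θ G P Z n) μ ∧
    Integrable (SAA.supDeviation Θ' G P Z n) μ ∧
    ∫ ω, SAA.optimalValueError Θ G P Z n ω ∂μ ≤ ∫ ω, SAA.supDeviation Θ' G P Z n ω ∂μ ∧
    ENNReal.ofReal (∫ ω, SAA.supDeviation Θ' G P Z n ω ∂μ) ≤
      ENNReal.ofReal (16 * Real.sqrt 2) * eLpNorm ξ 2 P / ENNReal.ofReal (Real.sqrt n) *
        SAA.entropyIntegral (G '' Θ) ξ (1 / 2) := by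
  have : IsProbabilityMeasure P := by
    rw [← hZlaw 0]
    exact Measure.isProbabilityMeasure_map (hZ 0).aemeasurable
  have hlaw := SAA.map_sample_eq_pi hZ hZindep hZlaw n
  have hae := SAA.ae_iInf_sampleAverage_eq hZ hlaw hA3 hA2 hΘ hn
  have hle := SAA.ae_optimalValueError_le_supDeviation hA3 hA2 hΘ hae
  have hsup := SAA.integrable_supDeviation (n := n) hZ hZlaw hA1 hA3 hA2 hΘ
  have hopt : Integrable (SAA.optimalValueError Θ G P Z n) μ := by
    refine hsup.mono' (SAA.aestronglyMeasurable_optimalValueError hZ hA1 hA3 hae) ?_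
    filter_upwards [hle] with ω hω
    rwa [SAA.optimalValueError, Real.norm_of_nonneg (abs_nonneg _)]
  refine ⟨hopt, hsup, integral_mono_ae hopt hsup hle, ?_⟩
  have hn' : (0 : ℝ) < n := by exact_mod_cast hn
  have hsqrt : 0 < Real.sqrt n := Real.sqrt_pos.2 hn'
  rw [SAA.ofReal_integral_supDeviation_eq hZ hZindep hZlaw hA1 hA3 hA2 hΘ hn]
  calc _ ≤ ENNReal.ofReal (1 / n) * (ENNReal.ofReal (8 * Real.sqrt 2) *
        ENNReal.ofReal (Real.sqrt n) * eLpNorm ξ 2 P * SAA.entropyIntegral (G '' Θ) ξ (1 / 2)) := by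
        gcongr
        exact SAA.lintegral_iSup_enorm_centered_le_entropyIntegral hn hA3.subset hA3.countable hΘ
          (fun θ hθ => hA1 θ (hA3.subset hθ))
          (fun θ hθ => hA2.integrable_goal hA1 (hA3.subset hθ)) hA2.measurable hA2.pos hA2.bound
    _ = ENNReal.ofReal (8 * Real.sqrt 2) * eLpNorm ξ 2 P / ENNReal.ofReal (Real.sqrt n) *
        SAA.entropyIntegral (G '' Θ) ξ (1 / 2) := by
        have hdiv : ENNReal.ofReal (1 / n) * ENNReal.ofReal (Real.sqrt n) =
            (ENNReal.ofReal (Real.sqrt n))⁻¹ := by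
          rw [← ENNReal.ofReal_mul (by positivity), ← ENNReal.ofReal_inv_of_pos hsqrt]
          congr 1
          field_simp
          exact Real.sq_sqrt hn'.le
        rw [div_eq_mul_inv (ENNReal.ofReal _ * _), ← hdiv]
        ring
    _ ≤ _ := by
        gcongr
        norm_num
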